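/- \textbf{Theorem (Client-Perceived Safety of Lutris).} \emph{Model.} The system runs in epochs $e=0,1,2,\dots$; epoch $e$ has a finite committee of validators with integer stakes, of total stake $W_e$, and a set of Byzantine validators whose stake in the committee is less than $W_e/3$. A quorum is a set of committee members of stake at least $\lfloor 2W_e/3\rfloor+1$ (with $3f+1$ validators of stake $1$: at most $f$ Byzantine ones, quorums of $2f+1$). Communication is asynchronous; Byzantine validators send arbitrary messages under their own keys of the epochs in which they are Byzantine. Each epoch has a consensus that outputs a growing sequence of commits, the same for all, each a list of inputs of validators: certified transactions, and calls to the reconfiguration contract authenticated by their callers. A transaction has owned (among them a gas object), read-only and shared input objects; every object is a genesis object or was created by a transaction. The inputs of a transaction are available at a validator if the creators of all its input objects have been executed there and none of its owned inputs has been consumed there. A correct committee member of epoch $e$ behaves as follows. \begin{itemize} \item It signs a valid transaction whose inputs are available, if none of the owned inputs is locked for another transaction, and locks them. A transaction certificate for epoch $e$ consists of such signatures by a quorum. \item It may record certificates received from clients, which it then submits to consensus. \item It executes a certified transaction not executed before whose inputs are available, signs its effects, and submits the certificate to consensus. The certificate is one it has received in the consensus output or, if there are no shared inputs, from a client. All transactions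 on a common shared object that were sequenced earlier in the epoch must have been executed before. An \emph{effect certificate} over $Tx$ for epoch $e$ consists of signatures by a quorum on the same effects of $Tx$. \item There is one checkpoint per commit. It contains the transactions of the commit with their causal histories (creators of inputs, and transactions sequenced before on a common shared object), except what is in earlier checkpoints. It is created as soon as all causal histories for this commit and the preceding ones are sequenced. \item The reconfiguration contract is run on the consensus output. Candidates with enough stake register for the next committee; after a given number of checkpoints, registered candidates declare themselves ready; once a quorum of the next committee is ready, correct validators stop signing transactions and stop accepting certificates from clients. A correct member then calls \textsf{End-of-Epoch} only once all certificates that it has recorded or executed in the epoch are in the consensus output it has received. After calls by distinct members forming a quorum and one more checkpoint, a call to \textsf{Handover} ends the epoch; commits end with it. \item On seeing the end of the epoch, a validator drops its locks, reverts the execution of all transactions that are in no checkpoint so far, has executed all those that are in one, and enters epoch $e+1$ in this state. \end{itemize} \emph{Statement.} Consider any infinite run of this system, and suppose that at some time there exists an effect certificate over a transaction $Tx$ for epoch $e$. Then: \begin{enumerate} \item no validator that is correct in its current epoch ever reverts the execution of $Tx$ while in epoch $e$ or a later one (in particular, not when leaving epoch $e$); \item every validator that is correct in its current epoch and is in an epoch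 later than $e$ has executed $Tx$; \item epoch $e$ does not end without $Tx$: whenever epoch $e$ has ended, $Tx$ is in a checkpoint of epoch $e$; \item suppose moreover that consensus is live within each epoch, i.e. every input of a correct committee member is eventually sequenced unless the epoch ends, and every correct committee member eventually receives each commit of its epoch. Then every correct committee member of epoch $e$ that enters epoch $e$ assembles, while still in epoch $e$, a checkpoint of epoch $e$ that contains $Tx$. \end{enumerate} -/

import Mathlib

/-!
The Lutris protocol as an asynchronous transition system: validators sign transactions and
effects, consensus orders certificates and calls to the reconfiguration contract, checkpoints are
computed from the consensus commits, and a hand-over ends each epoch.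
-/

namespace Lutris

/-- An object key: the pair of an object identifier and a version. -/
structure ObjKey (ObjID : Type*) where
  id : ObjID
  version : ℕ

/-- The application data (transactions and objects) and the on-chain parameters.
Nothing is assumed about any of the fields. -/
structure System (V Tx ObjID : Type*) where
  /-- the gas object of a transaction -/
  gas : Tx → ObjKey ObjID
  /-- the other owned input objects -/
  owned : Tx → Finset (ObjKey ObjID)
  /-- the read-only input objects -/
  readonly : Tx → Finset (ObjKey ObjID)
  /-- the shared input objects, referred to by identifier and initial version -/
  shared : Tx → Finset (ObjKey ObjID)
  /-- the transaction that created the object with this key; `none` for a genesis object -/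
  parent : ObjKey ObjID → Option Tx
  /-- the authorization and gas check on a transaction -/
  valid : Tx → Prop
  /-- the committee of epoch `0` -/
  genesis : Finset V
  /-- `stake e v` is the stake of `v` in epoch `e` -/
  stake : ℕ → V → ℕ
  /-- the minimum stake for becoming a validator -/
  minStake : ℕ
  /-- the number of checkpoints of an epoch before the epoch change may begin -/
  minSeq : ℕ

/-- What consensus orders: transaction certificates and (authenticated) calls to the
reconfiguration contract. -/
inductive Entry (V Tx : Type*) where
  | tx (T : Tx)
  | register (v : V)
  | ready (v : V)
  | endOfEpoch (v : V)
  | handover (v : V)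

/-- The transaction of a consensus entry, if it is a certificate. -/
def Entry.tx? {V Tx : Type*} : Entry V Tx → Option Tx
  | .tx T => some T
  | _ => none

/-- The consensus output of one epoch: a sequence of commits, each a list of entries. -/
abbrev Log (V Tx : Type*) := List (List (Entry V Tx))

/-- The transactions sequenced in a log, in order. -/
def Log.txs {V Tx : Type*} (L : Log V Tx) : List Tx := L.flatten.filterMap Entry.tx?

section Objects

variable {V Tx ObjID : Type*} (P : System V Tx ObjID)

/-- `k` is an owned input of `T` (the gas object is always one). -/
def IsOwnedInput (T : Tx) (k : ObjKey ObjID) : Prop := k = P.gas T ∨ k ∈ P.owned T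

/-- `k` is an input of `T`, of any kind. -/
def IsInput (T : Tx) (k : ObjKey ObjID) : Prop :=
  IsOwnedInput P T k ∨ k ∈ P.readonly T ∨ k ∈ P.shared T

/-- The two transactions have a shared input object in common. -/
def ShareObject (T T' : Tx) : Prop := ∃ k ∈ P.shared T, ∃ k' ∈ P.shared T', k.id = k'.id

/-- The object store is determined by the set `ct` of executed transactions: all input objects of
`T` can be loaded when each of them is a genesis object or was created by an executed transaction,
and no executed transaction has consumed one of the owned inputs. -/
def Loadable (ct : Set Tx) (T : Tx) : Prop :=
  (∀ k, IsInput P T k → ∀ T', P.parent k = some T' → T' ∈ ct) ∧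
    ∀ k, IsOwnedInput P T k → ∀ T' ∈ ct, ¬ IsOwnedInput P T' k

end Objects

section Checkpoints

variable {V Tx ObjID : Type*} (P : System V Tx ObjID)

/-- In the list `l`, `T'` occurs before the first occurrence of `T`. -/
def Precedes (l : List Tx) (T' T : Tx) : Prop :=
  ∃ l₁ l₂, l = l₁ ++ T :: l₂ ∧ T ∉ l₁ ∧ T' ∈ l₁

/-- `T'` is a direct causal dependency of `T` that is not already in a checkpoint of an earlier
epoch (`hist`): it created an input object of `T`, or it was sequenced before `T` on a common
shared object. -/
def Dep (hist : Set Tx) (L : Log V Tx) (T' T : Tx) : Prop :=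
  T' ∉ hist ∧
    ((∃ k, IsInput P T k ∧ P.parent k = some T') ∨
      (Precedes L.txs T' T ∧ ShareObject P T' T))

/-- `T'` belongs to the causal history of `T` (which includes `T`). -/
def InHistory (hist : Set Tx) (L : Log V Tx) : Tx → Tx → Prop :=
  Relation.ReflTransGen (Dep P hist L)

/-- The causal histories of all transactions of the first `j` commits are sequenced in the log. -/
def CausallyComplete (hist : Set Tx) (L : Log V Tx) (j : ℕ) : Prop :=
  ∀ T ∈ Log.txs (L.take j), ∀ T', InHistory P hist L T' T → T' ∈ L.txs

open Classical in
/-- There is one checkpoint per commit; a checkpoint is created only once it (and every earlier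
one) is causally complete. This is the number of checkpoints that the commits in `L` give. -/
noncomputable def numCheckpoints (hist : Set Tx) (L : Log V Tx) : ℕ :=
  Nat.findGreatest (CausallyComplete P hist L) L.length

/-- The transactions in the checkpoint of commit number `j` (counted from `0`): those of the commit
with their causal histories, except those in earlier checkpoints. -/
def checkpoint (hist : Set Tx) (L : Log V Tx) (j : ℕ) : Set Tx :=
  {T' | T' ∉ hist ∧ (∃ T ∈ Log.txs (L.take (j + 1)), InHistory P hist L T' T) ∧
    ¬ ∃ T ∈ Log.txs (L.take j), InHistory P hist L T' T}

/-- The transactions in the checkpoints that the commits in `L` give. -/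
def checkpointed (hist : Set Tx) (L : Log V Tx) : Set Tx :=
  {T | ∃ j < numCheckpoints P hist L, T ∈ checkpoint P hist L j}

end Checkpoints

section Reconfiguration

variable {V Tx ObjID : Type*} (P : System V Tx ObjID)

/-- The phases of the reconfiguration contract within one epoch. -/
inductive Phase where
  | register
  | ready
  | endOfEpoch
  | handover
  | closed

/-- The state of the reconfiguration contract. `callers` is the set of validators whose stake has
been counted in the current phase (each validator counts once). -/
structure Contract (V : Type*) where
  phase : Phase
  newKeys : Finset V
  callers : Finset V
  edge : ℕ

open Classical in
/-- The stake in epoch `e` of those members of the committee `C` that lie in `A`. -/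
noncomputable def weight (e : ℕ) (C : Finset V) (A : Set V) : ℕ :=
  ∑ v ∈ C with v ∈ A, P.stake e v

/-- The total stake of the committee `C` in epoch `e`. -/
def totalStake (e : ℕ) (C : Finset V) : ℕ := ∑ v ∈ C, P.stake e v

/-- `A` holds a quorum of the stake of the committee `C` of epoch `e`; with `3f+1` validators of
stake `1` this says that `A` contains at least `2f+1` of them. -/
def IsQuorum (e : ℕ) (C : Finset V) (A : Set V) : Prop :=
  2 * totalStake P e C / 3 + 1 ≤ weight P e C A

open Classical in
/-- One call to the contract of epoch `e` with committee `old`, where `seq` is the number of the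
latest checkpoint. -/
noncomputable def Contract.step (e : ℕ) (old : Finset V) (seq : ℕ) (c : Contract V) :
    Entry V Tx → Contract V
  | .tx _ => c
  | .register v =>
    match c.phase with
    | .register =>
      if P.minStake ≤ P.stake (e + 1) v then { c with newKeys := insert v c.newKeys } else c
    | _ => c
  | .ready v =>
    let count (c : Contract V) : Contract V :=
      let callers := if v ∈ c.newKeys then insert v c.callers else c.callers
      if IsQuorum P (e + 1) c.newKeys callers
      then { c with phase := .endOfEpoch, callers := ∅ }
      else { c with callers := callers }
    match c.phase with
    | .register => if P.minSeq ≤ seq then count { c with phase := .ready } else c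
    | .ready => count c
    | _ => c
  | .endOfEpoch v =>
    match c.phase with
    | .endOfEpoch =>
      let callers := if v ∈ old then insert v c.callers else c.callers
      if IsQuorum P e old callers
      then { c with phase := .handover, callers := ∅, edge := seq }
      else { c with callers := callers }
    | _ => c
  | .handover _ =>
    match c.phase with
    | .handover => if c.edge + 1 ≤ seq then { c with phase := .closed } else c
    | _ => c

/-- The contract state of epoch `e` after the commits in `L`. The latest checkpoint that is known
when a commit is processed is the latest one that the preceding commits give. -/
noncomputable def contract (e : ℕ) (hist : Set Tx) (old : Finset V) (L : Log V Tx) : Contract V :=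
  (List.range L.length).foldl
    (fun c i => (L.getD i []).foldl
      (Contract.step P e old (numCheckpoints P hist (L.take i))) c)
    { phase := .register, newKeys := ∅, callers := ∅, edge := 0 }

/-- The transactions in checkpoints of epochs before `e`; `logs e` is the consensus output of
epoch `e`. -/
def hist (logs : ℕ → Log V Tx) : ℕ → Set Tx
  | 0 => ∅
  | e + 1 => hist logs e ∪ checkpointed P (hist logs e) (logs e)

open Classical in
/-- The committee of an epoch: the genesis committee, then the validators that were registered
when the preceding epoch was closed (no committee is determined before that). -/
noncomputable def committee (logs : ℕ → Log V Tx) : ℕ → Finset V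
  | 0 => P.genesis
  | e + 1 =>
    match contract P e (hist P logs e) (committee logs e) (logs e) with
    | { phase := .closed, newKeys := K, .. } => K
    | _ => ∅

/-- The phase of epoch `e` as seen after its first `i` commits. -/
noncomputable def phaseAt (logs : ℕ → Log V Tx) (e i : ℕ) : Phase :=
  (contract P e (hist P logs e) (committee P logs e) ((logs e).take i)).phase

/-- Epoch `e` has ended: its hand-over has been ordered by consensus. -/
def EpochEnded (logs : ℕ → Log V Tx) (e : ℕ) : Prop :=
  phaseAt P logs e (logs e).length = .closed

/-- The members of `A` that belong to the committee of epoch `e` form a quorum of it. -/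
def Quorum (logs : ℕ → Log V Tx) (e : ℕ) (A : Set V) : Prop :=
  IsQuorum P e (committee P logs e) A

end Reconfiguration

/-- The local state of a validator. -/
structure Local (Tx ObjID : Type*) where
  /-- the current epoch -/
  epoch : ℕ
  /-- the number of commits of this epoch received from consensus -/
  seen : ℕ
  /-- the executed transactions, those of earlier epochs included -/
  ct : Set Tx
  /-- the owned-object locks -/
  lock : ObjKey ObjID → Option Tx

/-- The global state: consensus outputs of all epochs, the local states, and all messages so far,
each with its epoch and its sender. -/
structure State (V Tx ObjID Eff : Type*) where
  logs : ℕ → Log V Tx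
  loc : V → Local Tx ObjID
  /-- signatures on transactions -/
  txSigs : Set (ℕ × V × Tx)
  /-- signatures on effects of transactions -/
  effSigs : Set (ℕ × V × Tx × Eff)
  /-- inputs of validators to consensus -/
  inputs : Set (ℕ × V × Entry V Tx)

section Protocol

variable {V Tx ObjID Eff : Type*} (P : System V Tx ObjID)

/-- At the start no message has been sent and every validator is in epoch `0`. -/
def State.initial : State V Tx ObjID Eff where
  logs := fun _ => []
  loc := fun _ => { epoch := 0, seen := 0, ct := ∅, lock := fun _ => none }
  txSigs := ∅
  effSigs := ∅
  inputs := ∅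

open Classical in
/-- Replace the local state of `v`. -/
noncomputable def State.setLoc (s : State V Tx ObjID Eff) (v : V) (l : Local Tx ObjID) :
    State V Tx ObjID Eff :=
  { s with loc := Function.update s.loc v l }

/-- A transaction certificate on `T` for epoch `e` exists: a quorum has signed `T`. -/
def TxCert (s : State V Tx ObjID Eff) (e : ℕ) (T : Tx) : Prop :=
  Quorum P s.logs e {v | (e, v, T) ∈ s.txSigs}

/-- An effect certificate on `T` for epoch `e` exists: a quorum has signed one and the same effects
structure of `T`. -/
def EffCert (s : State V Tx ObjID Eff) (e : ℕ) (T : Tx) : Prop :=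
  ∃ E : Eff, Quorum P s.logs e {v | (e, v, T, E) ∈ s.effSigs}

/-- The part of the consensus output of its current epoch that `v` has received. -/
def State.seenLog (s : State V Tx ObjID Eff) (v : V) : Log V Tx :=
  (s.logs (s.loc v).epoch).take (s.loc v).seen

/-- The phase of the current epoch in the view of `v`. -/
noncomputable def State.phase (s : State V Tx ObjID Eff) (v : V) : Phase :=
  phaseAt P s.logs (s.loc v).epoch (s.loc v).seen

/-- The transactions in the checkpoints of its current epoch that `v` has assembled. -/
def State.assembled (s : State V Tx ObjID Eff) (v : V) : Set Tx :=
  checkpointed P (hist P s.logs (s.loc v).epoch) (s.seenLog v)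

/-- `v` still signs transactions and accepts certificates from clients: in its view, the next
committee is not ready yet. -/
def State.accepting (s : State V Tx ObjID Eff) (v : V) : Prop :=
  s.phase P v = .register ∨ s.phase P v = .ready

/-- `v` is a correct validator of the committee of its current epoch. -/
def State.active (byz : ℕ → Set V) (s : State V Tx ObjID Eff) (v : V) : Prop :=
  v ∉ byz (s.loc v).epoch ∧ v ∈ committee P s.logs (s.loc v).epoch

open Classical in
/-- The steps of the system. `byz e` is the set of Byzantine validators of epoch `e`. -/
inductive Step (byz : ℕ → Set V) : State V Tx ObjID Eff → State V Tx ObjID Eff → Prop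
  /-- A correct validator locks the owned inputs of a valid transaction and signs it. -/
  | processTx (s : State V Tx ObjID Eff) (v : V) (T : Tx)
      (active : s.active P byz v)
      (accepting : s.accepting P v)
      (load : Loadable P (s.loc v).ct T)
      (valid : P.valid T)
      (free : ∀ k, IsOwnedInput P T k → (s.loc v).lock k = none ∨ (s.loc v).lock k = some T) :
      Step byz s
        { s.setLoc v { s.loc v with
            lock := fun k => if IsOwnedInput P T k then some T else (s.loc v).lock k } with
          txSigs := insert ((s.loc v).epoch, v, T) s.txSigs }
  /-- A correct validator records a certificate received from a client and schedules it for
  sequencing. -/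
  | recordCert (s : State V Tx ObjID Eff) (v : V) (T : Tx)
      (active : s.active P byz v)
      (accepting : s.accepting P v)
      (cert : TxCert P s (s.loc v).epoch T) :
      Step byz s { s with inputs := insert ((s.loc v).epoch, v, .tx T) s.inputs }
  /-- A correct validator executes a certificate, signs its effects and schedules the certificate
  for sequencing. The certificate comes from consensus, or (without shared inputs) from a client.
  With shared inputs it has to be the next one scheduled on each of its shared objects. The outcome
  `E` of the execution is not restricted. -/
  | processCert (s : State V Tx ObjID Eff) (v : V) (T : Tx) (E : Eff)
      (active : s.active P byz v)
      (cert : TxCert P s (s.loc v).epoch T)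
      (new : T ∉ (s.loc v).ct)
      (load : Loadable P (s.loc v).ct T)
      (source : T ∈ (s.seenLog v).txs ∨ (P.shared T = ∅ ∧ s.accepting P v))
      (next : ∀ T', Precedes (s.seenLog v).txs T' T → ShareObject P T' T → T' ∈ (s.loc v).ct) :
      Step byz s
        { s.setLoc v { s.loc v with ct := insert T (s.loc v).ct } with
          effSigs := insert ((s.loc v).epoch, v, T, E) s.effSigs
          inputs := insert ((s.loc v).epoch, v, .tx T) s.inputs }
  /-- A correct validator of the old committee calls the end of the epoch, once the new committee
  is ready and all certificates that it has recorded or executed in this epoch have been output by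
  consensus. -/
  | callEndOfEpoch (s : State V Tx ObjID Eff) (v : V)
      (active : s.active P byz v)
      (phase : s.phase P v = .endOfEpoch)
      (sequenced : ∀ T, ((s.loc v).epoch, v, .tx T) ∈ s.inputs → T ∈ (s.seenLog v).txs) :
      Step byz s { s with inputs := insert ((s.loc v).epoch, v, .endOfEpoch v) s.inputs }
  /-- Any correct party may call the other functions of the contract. -/
  | callOther (s : State V Tx ObjID Eff) (v : V) (x : Entry V Tx)
      (correct : v ∉ byz (s.loc v).epoch)
      (call : x = .register v ∨ x = .ready v ∨ x = .handover v) :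
      Step byz s { s with inputs := insert ((s.loc v).epoch, v, x) s.inputs }
  /-- A validator receives the next commit from consensus. -/
  | deliver (s : State V Tx ObjID Eff) (v : V)
      (more : (s.loc v).seen < (s.logs (s.loc v).epoch).length) :
      Step byz s (s.setLoc v { s.loc v with seen := (s.loc v).seen + 1 })
  /-- A validator that sees the end of the epoch enters the next one: it drops its locks, rolls
  back every transaction that is in no checkpoint so far, and has executed those that are in one. A
  new member of the committee synchronizes to the same state. -/
  | enterNextEpoch (s : State V Tx ObjID Eff) (v : V)
      (ended : s.phase P v = .closed) :
      Step byz s (s.setLoc v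
        { epoch := (s.loc v).epoch + 1
          seen := 0
          ct := hist P s.logs ((s.loc v).epoch + 1)
          lock := fun _ => none })
  /-- The consensus of a running epoch outputs a new commit. It orders only inputs of validators;
  transactions need a certificate, and contract calls are authenticated. -/
  | commit (s : State V Tx ObjID Eff) (e : ℕ) (c : List (Entry V Tx))
      (started : ∀ e' < e, EpochEnded P s.logs e')
      (running : ¬ EpochEnded P s.logs e)
      (admissible : ∀ x ∈ c,
        (∃ T v, x = .tx T ∧ (e, v, x) ∈ s.inputs ∧ TxCert P s e T) ∨
        (∃ v, (x = .register v ∨ x = .ready v ∨ x = .endOfEpoch v ∨ x = .handover v) ∧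
          (e, v, x) ∈ s.inputs)) :
      Step byz s { s with logs := Function.update s.logs e (s.logs e ++ [c]) }
  /-- A Byzantine validator signs any transaction. -/
  | byzTx (s : State V Tx ObjID Eff) (e : ℕ) (v : V) (T : Tx) (faulty : v ∈ byz e) :
      Step byz s { s with txSigs := insert (e, v, T) s.txSigs }
  /-- A Byzantine validator signs any effects. -/
  | byzEff (s : State V Tx ObjID Eff) (e : ℕ) (v : V) (T : Tx) (E : Eff) (faulty : v ∈ byz e) :
      Step byz s { s with effSigs := insert (e, v, T, E) s.effSigs }
  /-- A Byzantine validator gives any input to consensus. -/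
  | byzInput (s : State V Tx ObjID Eff) (e : ℕ) (v : V) (x : Entry V Tx) (faulty : v ∈ byz e) :
      Step byz s { s with inputs := insert (e, v, x) s.inputs }

/-- An infinite run of the system: from the initial state, every move is a step or idle. -/
def IsRun (byz : ℕ → Set V) (r : ℕ → State V Tx ObjID Eff) : Prop :=
  r 0 = State.initial ∧ ∀ t, Step P byz (r t) (r (t + 1)) ∨ r (t + 1) = r t

/-- In the committee of every epoch (as soon as it is determined), Byzantine validators hold less
than a third of the stake. -/
def BFT (byz : ℕ → Set V) (r : ℕ → State V Tx ObjID Eff) : Prop :=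
  ∀ t e, (committee P (r t).logs e).Nonempty →
    3 * weight P e (committee P (r t).logs e) (byz e) < totalStake P e (committee P (r t).logs e)

/-- The liveness of consensus within an epoch, for the correct members of its committee: whatever
they input is eventually sequenced unless the epoch ends, and they eventually receive every commit
of the epoch. -/
structure ConsensusLive (byz : ℕ → Set V) (r : ℕ → State V Tx ObjID Eff) : Prop where
  sequenced : ∀ t e v x, v ∉ byz e → v ∈ committee P (r t).logs e → (e, v, x) ∈ (r t).inputs →
    ∃ t', x ∈ ((r t').logs e).flatten ∨ EpochEnded P (r t').logs e
  delivered : ∀ t e v, v ∉ byz e → v ∈ committee P (r t).logs e → ((r t).loc v).epoch = e →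
    ∃ t' ≥ t, ((r t').loc v).epoch = e ∧ ((r t).logs e).length ≤ ((r t').loc v).seen

/-- The execution of `T` is reverted by `v` in the move from `s` to `s'`. -/
def Reverted (s s' : State V Tx ObjID Eff) (v : V) (T : Tx) : Prop :=
  T ∈ (s.loc v).ct ∧ T ∉ (s'.loc v).ct

end Protocol

end Lutris

/-! Everything rests on quorum intersection: two quorums of one committee share a correct member
(`IsQuorum.exists_correct`). An epoch can close only after a quorum of its committee has called for
its end (`EpochEnded.quorum`). A correct member calls only when all certificates it has input are
sequenced, and from then on it inputs only certificates already in its consensus output, since it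
accepts none from clients any more (`Step.sequenced`). So once an epoch has ended, every quorum
contains a correct member all of whose certificates are sequenced (`IsRun.exists_sequenced`).

Applied to the signers of an effect certificate, this shows that the transaction is sequenced.
Applied to the signers of any sequenced certificate, it shows that the creators of its inputs, which
such a signer had executed, are in checkpoints of earlier epochs or sequenced too. Hence all commits
of an ended epoch are causally complete (`IsRun.causallyComplete`) and the transaction is in a
checkpoint (`IsRun.mem_checkpointed`). Later epochs start from the checkpointed set `hist`, so it is
neither reverted nor missing there.

For the liveness claim, a member that leaves the epoch has seen its whole log, and one that stays is
delivered the whole log if the epoch ends. If the epoch never ends, the histories of the commits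
output so far lie among the transactions that are by now sequenced or executed by a correct member.
These are finitely many, so at some time all of them are sequenced
(`IsRun.exists_causallyComplete`). -/

namespace Lutris

/-! ### Causal histories and checkpoints of a growing log. -/

section Checkpoints

variable {V Tx ObjID : Type*} {P : System V Tx ObjID}

theorem Precedes.mem_left {l : List Tx} {T' T : Tx} (h : Precedes l T' T) : T' ∈ l := by
  obtain ⟨l₁, l₂, rfl, -, h⟩ := h
  exact List.mem_append_left _ h

/-- Only what stands before the first occurrence of `T` matters, and that part is fixed once `T` has
occurred. -/
theorem Precedes.of_prefix {l l' : List Tx} {T' T : Tx} (hl : l <+: l') (hT : T ∈ l)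
    (h : Precedes l' T' T) : Precedes l T' T := by
  obtain ⟨l₁, l₂, rfl, hn, hm⟩ := h
  obtain ⟨r, hr⟩ := hl
  obtain ⟨a, b, rfl, ha⟩ := List.eq_append_cons_of_mem hT
  refine ⟨a, b, rfl, ha, ?_⟩
  rw [List.append_assoc, List.cons_append] at hr
  rcases List.append_eq_append_iff.mp hr with ⟨c, h1, h2⟩ | ⟨c, h1, h2⟩
  · cases c with
    | nil => simpa [h1] using hm
    | cons x c =>
      simp only [List.cons_append, List.cons.injEq] at h2
      exact absurd (by rw [h1, h2.1]; simp) hn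
  · cases c with
    | nil => simpa [h1] using hm
    | cons x c => rw [h1]; exact List.mem_append_left _ hm

theorem Log.mem_txs {L : Log V Tx} {T : Tx} : T ∈ L.txs ↔ Entry.tx T ∈ L.flatten := by
  unfold Log.txs
  rw [List.mem_filterMap]
  constructor
  · rintro ⟨x, hx, h⟩
    cases x <;> simp_all [Entry.tx?]
  · exact fun h => ⟨_, h, rfl⟩

theorem Log.txs_prefix {L L' : Log V Tx} (h : L <+: L') : L.txs <+: L'.txs := by
  obtain ⟨r, rfl⟩ := h
  simp [Log.txs]

theorem Log.txs_subset {L L' : Log V Tx} (h : L <+: L') {T : Tx} (hT : T ∈ L.txs) : T ∈ L'.txs :=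
  (Log.txs_prefix h).subset hT

/-- A set of sequenced transactions that is closed under dependencies contains the histories. -/
theorem causallyComplete_of_closed {hist : Set Tx} {L : Log V Tx} {j : ℕ} (S : Set Tx)
    (hS : ∀ T ∈ Log.txs (L.take j), T ∈ S)
    (hclosed : ∀ T ∈ S, ∀ T', Dep P hist L T' T → T' ∈ S)
    (hseq : ∀ T ∈ S, T ∈ L.txs) : CausallyComplete P hist L j := by
  intro T hT T' h
  refine hseq T' ?_
  induction h using Relation.ReflTransGen.head_induction_on with
  | refl => exact hS T hT
  | head h _ ih => exact hclosed _ ih _ h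

/-- Sequenced transactions gain no dependencies when the log grows. Walking down a history in `L'`,
each member is already sequenced in `L`, so its next dependency is one in `L` as well. -/
theorem CausallyComplete.of_prefix {hist : Set Tx} {L L' : Log V Tx} {j : ℕ} (hL : L <+: L')
    (hj : j ≤ L.length) (h : CausallyComplete P hist L j) : CausallyComplete P hist L' j := by
  have htake : L'.take j = L.take j := by
    obtain ⟨r, rfl⟩ := hL
    simp [List.take_append_of_le_length hj]
  intro T hT T' hT'
  rw [htake] at hT
  have key : InHistory P hist L T' T := by
    induction hT' using Relation.ReflTransGen.head_induction_on with
    | refl => exact .refl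
    | head hd _ ih =>
      refine Relation.ReflTransGen.head ⟨hd.1, hd.2.imp_right fun hp => ⟨?_, hp.2⟩⟩ ih
      exact hp.1.of_prefix (Log.txs_prefix hL) (h T hT _ ih)
  exact Log.txs_subset hL (h T hT T' key)

/-- The checkpoint in question belongs to the first commit with `T` in its causal history, which may
come before the commit that sequences `T`. -/
theorem mem_checkpointed {hist : Set Tx} {L : Log V Tx} {j : ℕ} {T : Tx} (hj : j ≤ L.length)
    (h : CausallyComplete P hist L j) (hT : T ∈ Log.txs (L.take j)) (hn : T ∉ hist) :
    T ∈ checkpointed P hist L := by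
  classical
  have hex : ∃ i, ∃ U ∈ Log.txs (L.take i), InHistory P hist L T U := ⟨j, T, hT, .refl⟩
  have hpos : Nat.find hex ≠ 0 := by
    intro h0
    obtain ⟨U, hU, -⟩ := Nat.find_spec hex
    rw [h0] at hU
    simp [Log.txs] at hU
  -- Checkpoint `i` is built from the first `i + 1` commits, hence the shift by one. Minimality
  -- keeps `T` out of the earlier checkpoints.
  obtain ⟨i, hi⟩ := Nat.exists_eq_succ_of_ne_zero hpos
  refine ⟨i, ?_, hn, ?_, Nat.find_min hex (by omega)⟩
  · have h1 : Nat.find hex ≤ j := Nat.find_min' hex ⟨T, hT, .refl⟩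
    have h2 : j ≤ numCheckpoints P hist L := by
      unfold numCheckpoints
      exact Nat.le_findGreatest hj h
    omega
  · have := Nat.find_spec hex
    rwa [hi] at this

end Checkpoints

/-! ### Quorum intersection. -/

section Quorums

variable {V Tx ObjID : Type*} {P : System V Tx ObjID}

theorem weight_mono {e : ℕ} {C : Finset V} {A B : Set V} (h : A ⊆ B) :
    weight P e C A ≤ weight P e C B := by
  classical
  unfold weight
  refine Finset.sum_le_sum_of_subset fun v hv => ?_
  simp only [Finset.mem_filter] at hv ⊢
  exact ⟨hv.1, h hv.2⟩

theorem IsQuorum.mono {e : ℕ} {C : Finset V} {A B : Set V} (h : A ⊆ B) (hA : IsQuorum P e C A) :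
    IsQuorum P e C B :=
  le_trans hA (weight_mono h)

theorem IsQuorum.nonempty {e : ℕ} {C : Finset V} {A : Set V} (h : IsQuorum P e C A) :
    C.Nonempty := by
  rw [Finset.nonempty_iff_ne_empty]
  rintro rfl
  simp [IsQuorum, weight] at h

/-- Two quorums have a correct member in common. -/
theorem IsQuorum.exists_correct {e : ℕ} {C : Finset V} {A A' B : Set V}
    (hB : 3 * weight P e C B < totalStake P e C) (hA : IsQuorum P e C A)
    (hA' : IsQuorum P e C A') : ∃ v ∈ C, v ∈ A ∧ v ∈ A' ∧ v ∉ B := by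
  classical
  by_contra! hcon
  -- Without a common correct member, whoever lies in both quorums lies in `B`. But the left side
  -- exceeds 4/3 of the total stake and the right side is below 4/3 of it.
  have key : weight P e C A + weight P e C A' ≤ totalStake P e C + weight P e C B := by
    unfold weight totalStake
    rw [Finset.sum_filter, Finset.sum_filter, Finset.sum_filter, ← Finset.sum_add_distrib,
      ← Finset.sum_add_distrib]
    refine Finset.sum_le_sum fun v hv => ?_
    have := hcon v hv
    split_ifs <;> simp_all
  unfold IsQuorum at hA hA'
  omega

end Quorums

/-! ### The reconfiguration contract and the stability of past epochs. -/

section Reconfiguration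

variable {V Tx ObjID : Type*} {P : System V Tx ObjID}

/-- The position of a phase within its epoch. -/
def Phase.rank : Phase → ℕ
  | .register => 0
  | .ready => 1
  | .endOfEpoch => 2
  | .handover => 3
  | .closed => 4

theorem Phase.eq_closed {p : Phase} (h : 4 ≤ p.rank) : p = .closed := by
  cases p <;> simp_all [Phase.rank]

theorem Phase.accepting_iff {p : Phase} : (p = .register ∨ p = .ready) ↔ p.rank ≤ 1 := by
  cases p <;> simp [Phase.rank]

theorem Contract.rank_le_step {e seq : ℕ} {old : Finset V} (c : Contract V) (x : Entry V Tx) :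
    c.phase.rank ≤ (Contract.step P e old seq c x).phase.rank := by
  have hite : ∀ {q : Prop} {_ : Decidable q} {n a b : ℕ}, n ≤ a → n ≤ b → n ≤ if q then a
      else b := by
    intros; split_ifs <;> assumption
  obtain ⟨p, K, A, g⟩ := c
  cases x <;> cases p <;> 
    simp only [Contract.step, apply_ite Contract.phase, apply_ite Phase.rank] <;>
    repeat' first | decide | apply hite

theorem Contract.rank_le_foldl {e seq : ℕ} {old : Finset V} (l : List (Entry V Tx))
    (c : Contract V) :
    c.phase.rank ≤ (l.foldl (Contract.step P e old seq) c).phase.rank := by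
  induction l generalizing c with
  | nil => exact le_rfl
  | cons x l ih => exact (Contract.rank_le_step c x).trans (ih _)

theorem contract_append {e : ℕ} {h : Set Tx} {old : Finset V} (L : Log V Tx)
    (c : List (Entry V Tx)) :
    contract P e h old (L ++ [c]) =
      c.foldl (Contract.step P e old (numCheckpoints P h L)) (contract P e h old L) := by
  unfold contract
  rw [List.length_append, List.length_singleton, List.range_succ, List.foldl_append]
  simp only [List.foldl_cons, List.foldl_nil]
  rw [List.take_left, List.getD_append_right _ _ _ _ le_rfl, Nat.sub_self, List.getD_cons_zero]
  congr 1
  refine List.foldl_ext _ _ _ fun d i hi => ?_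
  have hi := List.mem_range.mp hi
  rw [List.getD_append _ _ _ _ hi, List.take_append_of_le_length hi.le]

theorem contract_rank_mono {e : ℕ} {h : Set Tx} {old : Finset V} {L L' : Log V Tx}
    (hL : L <+: L') :
    (contract P e h old L).phase.rank ≤ (contract P e h old L').phase.rank := by
  obtain ⟨r, rfl⟩ := hL
  induction r using List.reverseRecOn with
  | nil => simp
  | append_singleton r c ih =>
    rw [← List.append_assoc, contract_append]
    exact ih.trans (Contract.rank_le_foldl _ _)

/-- The stake counted by the contract for the end of the epoch belongs to `A`. -/
def Contract.CalledBy (P : System V Tx ObjID) (e : ℕ) (old : Finset V) (A : Set V)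
    (c : Contract V) : Prop :=
  (c.phase = .endOfEpoch → ∀ v ∈ c.callers, v ∈ A) ∧ (3 ≤ c.phase.rank → IsQuorum P e old A)

/-- The caller set is emptied on entering the phase `.endOfEpoch`, so in that phase it holds only
authors of `.endOfEpoch` calls. When they reach a quorum, so does the larger set `A`, and this fact
no longer depends on the contract state. -/
theorem Contract.CalledBy.step {e seq : ℕ} {old : Finset V} {A : Set V} {c : Contract V}
    (h : c.CalledBy P e old A) {x : Entry V Tx} (hx : ∀ v, x = .endOfEpoch v → v ∈ A) :
    (Contract.step P e old seq c x).CalledBy P e old A := by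
  classical
  obtain ⟨p, K, B, g⟩ := c
  obtain ⟨h1, h2⟩ := h
  cases x with
  | endOfEpoch v =>
    have hv := hx v rfl
    cases p <;> simp only [Contract.step]
    case endOfEpoch =>
      have h1 : ∀ w ∈ B, w ∈ A := h1 rfl
      have hsub : ∀ w ∈ (if v ∈ old then insert v B else B), w ∈ A := by
        intro w hw
        split_ifs at hw
        · rcases Finset.mem_insert.mp hw with rfl | hw
          exacts [hv, h1 _ hw]
        · exact h1 _ hw
      by_cases hq : IsQuorum P e old ((if v ∈ old then insert v B else B : Finset V) : Set V)
      · have : (IsQuorum P e old A) := hq.mono fun w hw => hsub w hw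
        rw [if_pos hq]
        exact ⟨by simp, fun _ => this⟩
      · rw [if_neg hq]
        exact ⟨fun _ => hsub, fun h => by simp [Phase.rank] at h⟩
    all_goals exact ⟨h1, h2⟩
  | tx T => exact ⟨h1, h2⟩
  | register v =>
    cases p <;> simp only [Contract.step] <;> (try split_ifs) <;>
      simp_all [Contract.CalledBy, Phase.rank]
  | ready v =>
    cases p <;> simp only [Contract.step] <;> (try split_ifs) <;>
      simp_all [Contract.CalledBy, Phase.rank]
  | handover v =>
    cases p <;> simp only [Contract.step] <;> (try split_ifs) <;>
      simp_all [Contract.CalledBy, Phase.rank]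

theorem Contract.CalledBy.foldl {e seq : ℕ} {old : Finset V} {A : Set V} {c : Contract V}
    (h : c.CalledBy P e old A) {l : List (Entry V Tx)} (hl : ∀ v, .endOfEpoch v ∈ l → v ∈ A) :
    (l.foldl (Contract.step P e old seq) c).CalledBy P e old A := by
  induction l generalizing c with
  | nil => exact h
  | cons x l ih =>
    exact ih (h.step fun v hv => hl v (by simp [hv])) fun v hv => hl v (by simp [hv])

theorem contract_calledBy {e : ℕ} {h : Set Tx} {old : Finset V} {A : Set V} (L : Log V Tx)
    (hL : ∀ v, .endOfEpoch v ∈ L.flatten → v ∈ A) :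
    (contract P e h old L).CalledBy P e old A := by
  induction L using List.reverseRecOn with
  | nil => simp [contract, Contract.CalledBy, Phase.rank]
  | append_singleton L c ih =>
    rw [contract_append]
    refine (ih fun v hv => hL v ?_).foldl fun v hv => hL v ?_ <;>
    · rw [List.flatten_append]; simp only [List.mem_append]; simp [hv]

/-- A closed epoch has been ended by a quorum of its committee. -/
theorem EpochEnded.quorum {logs : ℕ → Log V Tx} {e : ℕ} (h : EpochEnded P logs e) :
    Quorum P logs e {v | .endOfEpoch v ∈ (logs e).flatten} := by
  unfold EpochEnded phaseAt at h
  rw [List.take_length] at h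
  exact (contract_calledBy (logs e) fun v hv => hv).2 (by rw [h]; simp [Phase.rank])

theorem phaseAt_rank_mono {logs : ℕ → Log V Tx} {e i j : ℕ} (h : i ≤ j) :
    (phaseAt P logs e i).rank ≤ (phaseAt P logs e j).rank :=
  contract_rank_mono (List.take_prefix_take_left h)

theorem epochEnded_of_phaseAt {logs : ℕ → Log V Tx} {e i : ℕ} (hi : i ≤ (logs e).length)
    (h : phaseAt P logs e i = .closed) : EpochEnded P logs e :=
  Phase.eq_closed (by
    have := phaseAt_rank_mono (P := P) (logs := logs) (e := e) hi
    rwa [h] at this)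

theorem EpochEnded.ne_nil {logs : ℕ → Log V Tx} {e : ℕ} (h : EpochEnded P logs e) :
    logs e ≠ [] := by
  intro h0
  simp [EpochEnded, phaseAt, h0, contract] at h

/-- The starting state of an epoch depends on earlier logs only. As logs of ended epochs are frozen,
`hist` and `committee` are constant in time once the epoch has started. -/
theorem hist_congr {logs logs' : ℕ → Log V Tx} {e : ℕ} (h : ∀ e' < e, logs' e' = logs e') :
    hist P logs' e = hist P logs e := by
  induction e with
  | zero => rfl
  | succ e ih =>
    rw [hist, hist, ih fun e' he => h e' (by omega), h e (by omega)]

theorem committee_congr {logs logs' : ℕ → Log V Tx} {e : ℕ} (h : ∀ e' < e, logs' e' = logs e') :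
    committee P logs' e = committee P logs e := by
  induction e with
  | zero => rfl
  | succ e ih =>
    rw [committee, committee, ih fun e' he => h e' (by omega), h e (by omega),
      hist_congr fun e' he => h e' (by omega)]

theorem phaseAt_congr {logs logs' : ℕ → Log V Tx} {e i : ℕ} (h : ∀ e' < e, logs' e' = logs e')
    (hp : logs e <+: logs' e) (hi : i ≤ (logs e).length) :
    phaseAt P logs' e i = phaseAt P logs e i := by
  obtain ⟨r, hr⟩ := hp
  unfold phaseAt
  rw [hist_congr h, committee_congr h, ← hr, List.take_append_of_le_length hi]

theorem hist_mono {logs : ℕ → Log V Tx} : Monotone (hist P logs) :=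
  monotone_nat_of_le_succ fun _ => Set.subset_union_left

/-- All epochs before `e` have ended. -/
def Started (P : System V Tx ObjID) (logs : ℕ → Log V Tx) (e : ℕ) : Prop :=
  ∀ e' < e, EpochEnded P logs e'

theorem Started.congr {logs logs' : ℕ → Log V Tx} {e : ℕ} (hs : Started P logs e)
    (h : ∀ e' < e, logs' e' = logs e') : Started P logs' e := by
  intro e' he
  have := hs e' he
  unfold EpochEnded at this ⊢
  rwa [h e' he, phaseAt_congr (fun d hd => h d (hd.trans he)) (by rw [h e' he]) le_rfl]

/-- An undetermined committee is empty by default, so any quorum of an epoch witnesses that the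
preceding one has ended. -/
theorem epochEnded_of_committee_nonempty {logs : ℕ → Log V Tx} {e : ℕ}
    (h : (committee P logs (e + 1)).Nonempty) : EpochEnded P logs e := by
  unfold EpochEnded phaseAt
  rw [List.take_length]
  rw [committee] at h
  split at h
  · next h' => rw [h']
  · simp at h

end Reconfiguration

/-! ### Monotonicity of runs and the order of epochs. -/

section Runs

variable {V Tx ObjID Eff : Type*} {P : System V Tx ObjID} {byz : ℕ → Set V}
  {s s' : State V Tx ObjID Eff}

/-- Epochs come one after the other, and the commits of an epoch end when it is closed. -/
structure EpochOrder (P : System V Tx ObjID) (s : State V Tx ObjID Eff) : Prop where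
  log_started : ∀ e, s.logs e ≠ [] → Started P s.logs e
  not_closed : ∀ e i, i < (s.logs e).length → phaseAt P s.logs e i ≠ .closed
  loc_started : ∀ v, Started P s.logs (s.loc v).epoch
  seen_le : ∀ v, (s.loc v).seen ≤ (s.logs (s.loc v).epoch).length

theorem EpochOrder.started_succ (h : EpochOrder P s) {e : ℕ} (he : EpochEnded P s.logs e) :
    Started P s.logs (e + 1) := by
  intro e' he'
  rcases Nat.lt_succ_iff_lt_or_eq.mp he' with h' | rfl
  exacts [h.log_started e he.ne_nil e' h', he]

theorem EpochOrder.started_of_quorum (h : EpochOrder P s) {e : ℕ} {A : Set V}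
    (hA : Quorum P s.logs e A) : Started P s.logs e := by
  cases e with
  | zero => exact fun _ h => absurd h (Nat.not_lt_zero _)
  | succ e => exact h.started_succ (epochEnded_of_committee_nonempty (IsQuorum.nonempty hA))

theorem EpochOrder.epochEnded (h : EpochOrder P s) {v : V} (hv : s.phase P v = .closed) :
    EpochEnded P s.logs (s.loc v).epoch :=
  epochEnded_of_phaseAt (h.seen_le v) hv

/-- No proper prefix of a log is closed, so seeing the end of an epoch means having seen all its
commits. -/
theorem EpochOrder.seenLog_eq (h : EpochOrder P s) {v : V} (hv : s.phase P v = .closed) :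
    s.seenLog v = s.logs (s.loc v).epoch := by
  refine List.take_of_length_le (not_lt.mp fun hlt => ?_)
  exact h.not_closed _ _ hlt hv

/-- The later state has all the messages of the earlier one, and the past epochs are the same. -/
structure Extends (P : System V Tx ObjID) (s s' : State V Tx ObjID Eff) : Prop where
  logs_prefix : ∀ e, s.logs e <+: s'.logs e
  frozen : ∀ e, EpochEnded P s.logs e → s'.logs e = s.logs e
  txSigs : s.txSigs ⊆ s'.txSigs
  effSigs : s.effSigs ⊆ s'.effSigs
  inputs : s.inputs ⊆ s'.inputs

theorem Extends.refl (s : State V Tx ObjID Eff) : Extends P s s :=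
  ⟨fun _ => List.prefix_rfl, fun _ _ => rfl, subset_rfl, subset_rfl, subset_rfl⟩

theorem Extends.below (h : Extends P s s') {e : ℕ} (hs : Started P s.logs e) :
    ∀ e' < e, s'.logs e' = s.logs e' :=
  fun e' he => h.frozen e' (hs e' he)

theorem Extends.started (h : Extends P s s') {e : ℕ} (hs : Started P s.logs e) :
    Started P s'.logs e :=
  hs.congr (h.below hs)

theorem Extends.hist_eq (h : Extends P s s') {e : ℕ} (hs : Started P s.logs e) :
    hist P s'.logs e = hist P s.logs e :=
  hist_congr (h.below hs)

theorem Extends.committee_eq (h : Extends P s s') {e : ℕ} (hs : Started P s.logs e) :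
    committee P s'.logs e = committee P s.logs e :=
  committee_congr (h.below hs)

theorem Extends.phaseAt_eq (h : Extends P s s') {e i : ℕ} (hs : Started P s.logs e)
    (hi : i ≤ (s.logs e).length) : phaseAt P s'.logs e i = phaseAt P s.logs e i :=
  phaseAt_congr (h.below hs) (h.logs_prefix e) hi

theorem Extends.epochEnded (h : Extends P s s') (ho : EpochOrder P s) {e : ℕ}
    (he : EpochEnded P s.logs e) : EpochEnded P s'.logs e :=
  h.started (ho.started_succ he) e (Nat.lt_succ_self e)

theorem Extends.trans {s'' : State V Tx ObjID Eff} (h : Extends P s s') (h' : Extends P s' s'')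
    (ho : EpochOrder P s) : Extends P s s'' where
  logs_prefix e := (h.logs_prefix e).trans (h'.logs_prefix e)
  frozen e he := (h'.frozen e (h.epochEnded ho he)).trans (h.frozen e he)
  txSigs := h.txSigs.trans h'.txSigs
  effSigs := h.effSigs.trans h'.effSigs
  inputs := h.inputs.trans h'.inputs

theorem Extends.quorum (h : Extends P s s') (ho : EpochOrder P s) {e : ℕ} {A B : Set V}
    (hAB : A ⊆ B) (hA : Quorum P s.logs e A) : Quorum P s'.logs e B := by
  unfold Quorum
  rw [h.committee_eq (ho.started_of_quorum hA)]
  exact IsQuorum.mono hAB hA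

theorem Extends.txCert (h : Extends P s s') (ho : EpochOrder P s) {e : ℕ} {T : Tx}
    (hT : TxCert P s e T) : TxCert P s' e T :=
  h.quorum ho (fun _ hv => h.txSigs hv) hT

theorem Extends.effCert (h : Extends P s s') (ho : EpochOrder P s) {e : ℕ} {T : Tx}
    (hT : EffCert P s e T) : EffCert P s' e T :=
  hT.imp fun _ hE => h.quorum ho (fun _ hv => h.effSigs hv) hE

theorem Step.extends (hs : Step P byz s s') : Extends P s s' := by
  cases hs with
  | commit e c started running admissible =>
    refine ⟨fun e' => ?_, fun e' he' => ?_, subset_rfl, subset_rfl, subset_rfl⟩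
    · by_cases h : e' = e
      · subst h; simp
      · simp [Function.update_of_ne h]
    · exact Function.update_of_ne (by rintro rfl; exact running he') _ _
  | _ =>
    exact ⟨fun _ => List.prefix_rfl, fun _ _ => rfl, by simp [State.setLoc],
      by simp [State.setLoc], by simp [State.setLoc]⟩

/-- A validator stays in its epoch, or it enters the next one at the end of the epoch. -/
theorem Step.loc (hs : Step P byz s s') (v : V) :
    ((s'.loc v).epoch = (s.loc v).epoch ∧ (s.loc v).seen ≤ (s'.loc v).seen ∧
      (s.loc v).ct ⊆ (s'.loc v).ct) ∨
    (s'.logs = s.logs ∧ s.phase P v = .closed ∧ (s'.loc v).epoch = (s.loc v).epoch + 1 ∧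
      (s'.loc v).seen = 0 ∧ (s'.loc v).ct = hist P s.logs ((s.loc v).epoch + 1)) := by
  cases hs with
  | enterNextEpoch w ended =>
    by_cases h : v = w
    · subst h; right; simp [State.setLoc, ended]
    · left; simp [State.setLoc, h]
  | processTx w | processCert w | deliver w =>
    left
    by_cases h : v = w
    · subst h; simp [State.setLoc]
    · simp [State.setLoc, h]
  | _ => exact .inl ⟨rfl, le_rfl, subset_rfl⟩

theorem Step.seen_le (hs : Step P byz s s')
    (h : ∀ v, (s.loc v).seen ≤ (s.logs (s.loc v).epoch).length) (v : V) :
    (s'.loc v).seen ≤ (s'.logs (s'.loc v).epoch).length := by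
  have hp := (hs.extends.logs_prefix (s.loc v).epoch).length_le
  have hv := h v
  cases hs with
  | enterNextEpoch w | processTx w | processCert w | deliver w =>
    by_cases h : v = w
    · subst h; simp [State.setLoc]; try omega
    · simpa [State.setLoc, h] using hv
  | _ => exact hv.trans hp

theorem Step.epochOrder (hs : Step P byz s s') (h : EpochOrder P s) : EpochOrder P s' := by
  have hx := hs.extends
  refine ⟨fun e he => ?_, fun e i hi => ?_, fun v => ?_, hs.seen_le h.seen_le⟩
  · by_cases h0 : s.logs e = []
    · cases hs with
      | commit e' c started running admissible =>
        by_cases hee : e = e'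
        · subst hee; exact hx.started started
        · simp [Function.update_of_ne hee, h0] at he
      | _ => exact absurd h0 he
    · exact hx.started (h.log_started e h0)
  · rcases lt_or_ge i (s.logs e).length with hlt | hge
    · rw [hx.phaseAt_eq (h.log_started e (by rintro h0; simp [h0] at hlt)) hlt.le]
      exact h.not_closed e i hlt
    · cases hs with
      | commit e' c started running admissible =>
        by_cases hee : e = e'
        · subst hee
          -- The only new proper prefix is the old log itself, which was not closed when the commit
          -- was made.
          have : i = (s.logs e).length := by
            simp at hi; omega
          subst this
          rw [hx.phaseAt_eq started le_rfl]
          exact running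
        · simp [Function.update_of_ne hee] at hi; omega
      | _ => exact absurd hi (not_lt.mpr hge)
  · rcases hs.loc v with ⟨h1, -⟩ | ⟨h1, h2, h3, -⟩
    · rw [h1]; exact hx.started (h.loc_started v)
    · rw [h1, h3]; exact h.started_succ (h.epochEnded h2)

theorem epochOrder_initial : EpochOrder P (State.initial : State V Tx ObjID Eff) :=
  ⟨fun _ h => absurd rfl h, fun _ _ h => absurd h (Nat.not_lt_zero _),
    fun _ _ h => absurd h (Nat.not_lt_zero _), fun _ => le_rfl⟩

variable {r : ℕ → State V Tx ObjID Eff}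

theorem IsRun.epochOrder (hr : IsRun P byz r) (t : ℕ) : EpochOrder P (r t) := by
  induction t with
  | zero => rw [hr.1]; exact epochOrder_initial
  | succ t ih =>
    rcases hr.2 t with h | h
    · exact h.epochOrder ih
    · rwa [h]

theorem IsRun.extends (hr : IsRun P byz r) {t t' : ℕ} (h : t ≤ t') :
    Extends P (r t) (r t') := by
  induction h with
  | refl => exact .refl _
  | step _ ih =>
    refine ih.trans ?_ (hr.epochOrder t)
    rcases hr.2 _ with h | h
    · exact h.extends
    · rw [h]; exact .refl _

/-- A validator leaves an epoch only at its end, with all its commits. -/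
theorem IsRun.exists_seenLog_eq (hr : IsRun P byz r) {v : V} {t t' : ℕ} (h : t ≤ t')
    (hne : ((r t').loc v).epoch ≠ ((r t).loc v).epoch) :
    ∃ u, ((r u).loc v).epoch = ((r t).loc v).epoch ∧ EpochEnded P (r u).logs ((r t).loc v).epoch ∧
      (r u).seenLog v = (r u).logs ((r t).loc v).epoch := by
  induction h with
  | refl => exact absurd rfl hne
  | @step m _ ih =>
    by_cases hm : ((r m).loc v).epoch = ((r t).loc v).epoch
    · rcases hr.2 m with h | h
      · rcases h.loc v with ⟨h1, -⟩ | ⟨-, h1, -⟩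
        · exact absurd (h1.trans hm) hne
        · have ho := hr.epochOrder m
          exact ⟨m, hm, hm ▸ ho.epochEnded h1, hm ▸ ho.seenLog_eq h1⟩
      · rw [h] at hne; exact absurd hm hne
    · exact ih hm

end Runs

/-! ### Invariants linking messages to the actions of correct validators. -/

section Soundness

variable {V Tx ObjID Eff : Type*} {P : System V Tx ObjID} {byz : ℕ → Set V}
  {s s' : State V Tx ObjID Eff}

/-- The transactions whose effects `v` has signed in epoch `e`. -/
def executed (s : State V Tx ObjID Eff) (e : ℕ) (v : V) : Set Tx :=
  {T | ∃ E, (e, v, T, E) ∈ s.effSigs}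

/-- The creators of the inputs of `T` had been executed by `v` in epoch `e` or before it. -/
def ParentsExecuted (P : System V Tx ObjID) (s : State V Tx ObjID Eff) (e : ℕ) (v : V) (T : Tx) :
    Prop :=
  ∀ k, IsInput P T k → ∀ T', P.parent k = some T' → T' ∈ hist P s.logs e ∪ executed s e v

/-- The properties of an execution of `T` by `v` in epoch `e`. -/
structure Executed (P : System V Tx ObjID) (s : State V Tx ObjID Eff) (e : ℕ) (v : V) (T : Tx) :
    Prop where
  started : Started P s.logs e
  fresh : T ∉ hist P s.logs e
  input : (e, v, .tx T) ∈ s.inputs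
  parents : ParentsExecuted P s e v T
  next : P.shared T = ∅ ∨ T ∈ (s.logs e).txs ∧ ∀ T', Precedes (s.logs e).txs T' T →
    ShareObject P T' T → T' ∈ hist P s.logs e ∪ executed s e v

theorem executed_mono (h : Extends P s s') (e : ℕ) (v : V) : executed s e v ⊆ executed s' e v :=
  fun _ hT => hT.imp fun _ hE => h.effSigs hE

theorem hist_union_executed_mono (h : Extends P s s') {e : ℕ} (hs : Started P s.logs e) (v : V) :
    hist P s.logs e ∪ executed s e v ⊆ hist P s'.logs e ∪ executed s' e v := by
  rw [h.hist_eq hs]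
  exact Set.union_subset_union_right _ (executed_mono h e v)

theorem ParentsExecuted.mono (h : Extends P s s') {e : ℕ} (hs : Started P s.logs e) {v : V}
    {T : Tx} (hT : ParentsExecuted P s e v T) : ParentsExecuted P s' e v T :=
  fun k hk T' hT' => hist_union_executed_mono h hs v (hT k hk T' hT')

theorem Executed.mono (h : Extends P s s') {e : ℕ} {v : V} {T : Tx} (hT : Executed P s e v T) :
    Executed P s' e v T where
  started := h.started hT.started
  fresh := by rw [h.hist_eq hT.started]; exact hT.fresh
  input := h.inputs hT.input
  parents := hT.parents.mono h hT.started
  next := by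
    refine hT.next.imp_right fun ⟨h1, h2⟩ => ?_
    refine ⟨Log.txs_subset (h.logs_prefix e) h1, fun T' hp hsh => ?_⟩
    exact hist_union_executed_mono h hT.started v
      (h2 T' (hp.of_prefix (Log.txs_prefix (h.logs_prefix e)) h1) hsh)

/-- The local view of `v` is past the point where it accepts certificates of epoch `e`. -/
def PastAccepting (P : System V Tx ObjID) (s : State V Tx ObjID Eff) (e : ℕ) (v : V) : Prop :=
  e < (s.loc v).epoch ∨ (s.loc v).epoch = e ∧ ¬ s.accepting P v

/-- Within an epoch the phase seen by `v` never goes back, and `v` never returns to an earlier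
epoch. -/
theorem Step.pastAccepting (hs : Step P byz s s') (ho : EpochOrder P s) {e : ℕ} {v : V}
    (h : PastAccepting P s e v) : PastAccepting P s' e v := by
  rcases hs.loc v with ⟨h1, h2, -⟩ | ⟨-, -, h1, -⟩
  · rcases h with h | ⟨rfl, h⟩
    · left; omega
    · refine .inr ⟨h1, fun hacc => h ?_⟩
      unfold State.accepting State.phase at hacc ⊢
      rw [Phase.accepting_iff] at hacc ⊢
      rw [← hs.extends.phaseAt_eq (ho.loc_started v) (ho.seen_le v), ← h1]
      exact (phaseAt_rank_mono h2).trans hacc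
  · left
    rcases h with h | ⟨h, -⟩ <;> omega

/-- What the messages of a reachable state say about its history. -/
structure Sound (P : System V Tx ObjID) (byz : ℕ → Set V) (s : State V Tx ObjID Eff) : Prop where
  hist_subset : ∀ v, hist P s.logs (s.loc v).epoch ⊆ (s.loc v).ct
  ct_subset : ∀ v, (s.loc v).ct ⊆
    hist P s.logs (s.loc v).epoch ∪ executed s (s.loc v).epoch v
  executed : ∀ e v T, v ∉ byz e → T ∈ executed s e v → Executed P s e v T
  signed : ∀ e v T, v ∉ byz e → (e, v, T) ∈ s.txSigs →
    Started P s.logs e ∧ ParentsExecuted P s e v T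
  certified : ∀ e T, .tx T ∈ (s.logs e).flatten → TxCert P s e T
  authentic : ∀ e v, .endOfEpoch v ∈ (s.logs e).flatten → (e, v, .endOfEpoch v) ∈ s.inputs
  past : ∀ e v, v ∉ byz e → (e, v, .endOfEpoch v) ∈ s.inputs → PastAccepting P s e v
  sequenced : ∀ e v, v ∉ byz e → (e, v, .endOfEpoch v) ∈ s.inputs → ∀ T,
    (e, v, .tx T) ∈ s.inputs → T ∈ (s.logs e).txs
  finite : s.effSigs.Finite

theorem sound_initial : Sound P byz (State.initial : State V Tx ObjID Eff) where
  hist_subset _ := subset_rfl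
  ct_subset _ := Set.empty_subset _
  executed _ _ _ _ h := absurd h.choose_spec (Set.notMem_empty _)
  signed _ _ _ _ h := absurd h (Set.notMem_empty _)
  certified _ _ h := absurd h List.not_mem_nil
  authentic _ _ h := absurd h List.not_mem_nil
  past _ _ _ h := absurd h (Set.notMem_empty _)
  sequenced _ _ _ h := absurd h (Set.notMem_empty _)
  finite := Set.finite_empty

theorem Step.hist_subset (hs : Step P byz s s') (ho : EpochOrder P s) (h : Sound P byz s) (v : V) :
    hist P s'.logs (s'.loc v).epoch ⊆ (s'.loc v).ct := by
  rcases hs.loc v with ⟨h1, -, h2⟩ | ⟨h1, -, h2, -, h3⟩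
  · rw [h1, hs.extends.hist_eq (ho.loc_started v)]
    exact (h.hist_subset v).trans h2
  · rw [h1, h2, h3]

theorem Step.ct_subset (hs : Step P byz s s') (ho : EpochOrder P s) (h : Sound P byz s) (v : V) :
    (s'.loc v).ct ⊆ hist P s'.logs (s'.loc v).epoch ∪ Lutris.executed s' (s'.loc v).epoch v := by
  have key := (h.ct_subset v).trans
    (hist_union_executed_mono hs.extends (ho.loc_started v) v)
  cases hs with
  | enterNextEpoch w =>
    by_cases hv : v = w
    · subst hv; simp [State.setLoc]
    · simpa [State.setLoc, hv] using key
  | processTx w | deliver w =>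
    by_cases hv : v = w
    · subst hv; simpa [State.setLoc] using key
    · simpa [State.setLoc, hv] using key
  | processCert w T E =>
    by_cases hv : v = w
    · subst hv
      simp only [State.setLoc, Function.update_self] at key ⊢
      exact Set.insert_subset (.inr ⟨E, Set.mem_insert _ _⟩) key
    · simpa [State.setLoc, hv] using key
  | _ => exact key

theorem State.seenLog_prefix (s : State V Tx ObjID Eff) (v : V) :
    s.seenLog v <+: s.logs (s.loc v).epoch :=
  List.take_prefix _ _

theorem Loadable.parentsExecuted (h : Sound P byz s) {v : V} {T : Tx}
    (hT : Loadable P (s.loc v).ct T) : ParentsExecuted P s (s.loc v).epoch v T :=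
  fun k hk T' hT' => h.ct_subset v (hT.1 k hk T' hT')

theorem Step.executed (hs : Step P byz s s') (ho : EpochOrder P s) (h : Sound P byz s)
    (e : ℕ) (v : V) (T : Tx) (hv : v ∉ byz e) (hT : T ∈ executed s' e v) :
    Executed P s' e v T := by
  have hx := hs.extends
  by_cases hold : T ∈ Lutris.executed s e v
  · exact (h.executed e v T hv hold).mono hx
  obtain ⟨E, hE⟩ := hT
  have hnew : (e, v, T, E) ∉ s.effSigs := fun hE => hold ⟨E, hE⟩
  cases hs with
  | processCert w U F active cert new load source next =>
    rcases hE with hE | hE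
    · obtain ⟨rfl, rfl, rfl, rfl⟩ : e = (s.loc w).epoch ∧ v = w ∧ T = U ∧ E = F := by
        simpa using hE
      have hst := ho.loc_started v
      refine ⟨hx.started hst, ?_, .inl rfl, (load.parentsExecuted h).mono hx hst, ?_⟩
      · rw [hx.hist_eq hst]
        -- The checkpointed past is part of `ct`, so what is new to `ct` is new to `hist`.
        exact fun hh => new (h.hist_subset v hh)
      · rcases source with hsrc | hsrc
        · right
          refine ⟨Log.txs_subset (s.seenLog_prefix v) hsrc, fun T' hp hsh => ?_⟩
          exact hist_union_executed_mono hx hst v (h.ct_subset v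
            (next T' (hp.of_prefix (Log.txs_prefix (s.seenLog_prefix v)) hsrc) hsh))
        · exact .inl hsrc.1
    · exact absurd hE hnew
  | byzEff e' w U F faulty =>
    rcases hE with hE | hE
    · obtain ⟨rfl, rfl, -⟩ : e = e' ∧ v = w ∧ T = U ∧ E = F := by simpa using hE
      exact absurd faulty hv
    · exact absurd hE hnew
  | _ => exact absurd hE hnew

theorem Step.signed (hs : Step P byz s s') (ho : EpochOrder P s) (h : Sound P byz s)
    (e : ℕ) (v : V) (T : Tx) (hv : v ∉ byz e) (hT : (e, v, T) ∈ s'.txSigs) :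
    Started P s'.logs e ∧ ParentsExecuted P s' e v T := by
  have hx := hs.extends
  by_cases hold : (e, v, T) ∈ s.txSigs
  · obtain ⟨h1, h2⟩ := h.signed e v T hv hold
    exact ⟨hx.started h1, h2.mono hx h1⟩
  cases hs with
  | processTx w U active accepting load valid free =>
    rcases hT with hT | hT
    · obtain ⟨rfl, rfl, rfl⟩ : e = (s.loc w).epoch ∧ v = w ∧ T = U := by simpa using hT
      have hst := ho.loc_started v
      exact ⟨hx.started hst, (load.parentsExecuted h).mono hx hst⟩
    · exact absurd hT hold
  | byzTx e' w U faulty =>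
    rcases hT with hT | hT
    · obtain ⟨rfl, rfl, -⟩ : e = e' ∧ v = w ∧ T = U := by simpa using hT
      exact absurd faulty hv
    · exact absurd hT hold
  | _ => exact absurd hT hold

theorem Step.mem_log (hs : Step P byz s s') {e : ℕ} {x : Entry V Tx}
    (hx : x ∈ (s'.logs e).flatten) : x ∈ (s.logs e).flatten ∨
      (∃ T v, x = .tx T ∧ (e, v, x) ∈ s.inputs ∧ TxCert P s e T) ∨
      (∃ v, (x = .register v ∨ x = .ready v ∨ x = .endOfEpoch v ∨ x = .handover v) ∧
        (e, v, x) ∈ s.inputs) := by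
  cases hs with
  | commit e' c started running admissible =>
    by_cases hee : e = e'
    · subst hee
      simp only [Function.update_self, List.flatten_append, List.mem_append] at hx
      exact hx.imp_right fun hx => admissible x (by simpa using hx)
    · left; simpa [Function.update_of_ne hee] using hx
  | _ => exact .inl hx

theorem Step.certified (hs : Step P byz s s') (ho : EpochOrder P s) (h : Sound P byz s)
    (e : ℕ) (T : Tx) (hT : .tx T ∈ (s'.logs e).flatten) : TxCert P s' e T := by
  refine hs.extends.txCert ho ?_
  rcases hs.mem_log hT with hT | ⟨U, v, hU, -, hc⟩ | ⟨v, hU, -⟩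
  · exact h.certified e T hT
  · cases hU; exact hc
  · simp at hU

theorem Step.authentic (hs : Step P byz s s') (h : Sound P byz s)
    (e : ℕ) (v : V) (hv : .endOfEpoch v ∈ (s'.logs e).flatten) :
    (e, v, .endOfEpoch v) ∈ s'.inputs := by
  refine hs.extends.inputs ?_
  rcases hs.mem_log hv with hv | ⟨U, v, hU, -⟩ | ⟨w, hU, hw⟩
  · exact h.authentic e v hv
  · simp at hU
  · obtain rfl : v = w := by simpa using hU
    exact hw

/-- A new call by a correct validator for the end of the epoch. -/
theorem Step.endOfEpoch (hs : Step P byz s s') {e : ℕ} {v : V} (hv : v ∉ byz e)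
    (hn : (e, v, .endOfEpoch v) ∈ s'.inputs) : (e, v, .endOfEpoch v) ∈ s.inputs ∨
      ((s.loc v).epoch = e ∧ s.phase P v = .endOfEpoch ∧ s'.loc = s.loc ∧ s'.logs = s.logs ∧
        ∀ T, (e, v, .tx T) ∈ s'.inputs → T ∈ (s.seenLog v).txs) := by
  by_cases hold : (e, v, Entry.endOfEpoch v) ∈ s.inputs
  · exact .inl hold
  right
  cases hs with
  | callEndOfEpoch w active phase sequenced =>
    rcases hn with hn | hn
    · obtain ⟨rfl, rfl⟩ : e = (s.loc w).epoch ∧ v = w := by simpa using hn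
      exact ⟨rfl, phase, rfl, rfl, fun T hT => sequenced T (by simpa using hT)⟩
    · exact absurd hn hold
  | byzInput e' w x faulty =>
    rcases hn with hn | hn
    · obtain ⟨rfl, rfl, -⟩ : e = e' ∧ v = w ∧ _ = x := by simpa using hn
      exact absurd faulty hv
    · exact absurd hn hold
  | callOther w x correct call =>
    rcases hn with hn | hn
    · obtain ⟨-, -, rfl⟩ : e = _ ∧ v = w ∧ _ = x := by simpa using hn
      simp at call
    · exact absurd hn hold
  | recordCert | processCert => simp [hold] at hn
  | _ => exact absurd hn hold

/-- A new certificate among the inputs of a correct validator. -/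
theorem Step.input_tx (hs : Step P byz s s') {e : ℕ} {v : V} {T : Tx} (hv : v ∉ byz e)
    (hn : (e, v, .tx T) ∈ s'.inputs) : (e, v, .tx T) ∈ s.inputs ∨
      ((s.loc v).epoch = e ∧ (s.accepting P v ∨ T ∈ (s.seenLog v).txs)) := by
  by_cases hold : (e, v, Entry.tx T) ∈ s.inputs
  · exact .inl hold
  right
  cases hs with
  | recordCert w U active accepting =>
    rcases hn with hn | hn
    · obtain ⟨rfl, rfl, -⟩ : e = (s.loc w).epoch ∧ v = w ∧ T = U := by simpa using hn
      exact ⟨rfl, .inl accepting⟩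
    · exact absurd hn hold
  | processCert w U F active cert new load source =>
    rcases hn with hn | hn
    · obtain ⟨rfl, rfl, rfl⟩ : e = (s.loc w).epoch ∧ v = w ∧ T = U := by simpa using hn
      exact ⟨rfl, source.symm.imp_left And.right⟩
    · exact absurd hn hold
  | byzInput e' w x faulty =>
    rcases hn with hn | hn
    · obtain ⟨rfl, rfl, -⟩ : e = e' ∧ v = w ∧ _ = x := by simpa using hn
      exact absurd faulty hv
    · exact absurd hn hold
  | callOther w x correct call =>
    rcases hn with hn | hn
    · obtain ⟨-, -, rfl⟩ : e = _ ∧ v = w ∧ _ = x := by simpa using hn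
      simp at call
    · exact absurd hn hold
  | callEndOfEpoch => simp [hold] at hn
  | _ => exact absurd hn hold

theorem Step.past (hs : Step P byz s s') (ho : EpochOrder P s) (h : Sound P byz s)
    (e : ℕ) (v : V) (hv : v ∉ byz e) (hn : (e, v, .endOfEpoch v) ∈ s'.inputs) :
    PastAccepting P s' e v := by
  refine hs.pastAccepting ho ?_
  rcases hs.endOfEpoch hv hn with hn | ⟨h1, h2, -⟩
  · exact h.past e v hv hn
  · exact .inr ⟨h1, by simp [State.accepting, h2]⟩

/-- At the call itself this is the guard of the step. After the call a new certificate cannot come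
from a client, because `v` is past accepting, so it was taken from the consensus output. -/
theorem Step.sequenced (hs : Step P byz s s') (h : Sound P byz s)
    (e : ℕ) (v : V) (hv : v ∉ byz e) (hn : (e, v, .endOfEpoch v) ∈ s'.inputs) (T : Tx)
    (hT : (e, v, .tx T) ∈ s'.inputs) : T ∈ (s'.logs e).txs := by
  refine Log.txs_subset (hs.extends.logs_prefix e) ?_
  rcases hs.endOfEpoch hv hn with hn | ⟨rfl, -, -, -, h2⟩
  · rcases hs.input_tx hv hT with hT | ⟨rfl, hT | hT⟩
    · exact h.sequenced e v hv hn T hT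
    · rcases h.past _ v hv hn with hp | hp
      · exact absurd hp (lt_irrefl _)
      · exact absurd hT hp.2
    · exact Log.txs_subset (s.seenLog_prefix v) hT
  · exact Log.txs_subset (s.seenLog_prefix v) (h2 T hT)

theorem Step.finite (hs : Step P byz s s') (h : s.effSigs.Finite) : s'.effSigs.Finite := by
  cases hs with
  | processCert | byzEff => exact h.insert _
  | _ => exact h

theorem Step.sound (hs : Step P byz s s') (ho : EpochOrder P s) (h : Sound P byz s) :
    Sound P byz s' where
  hist_subset := hs.hist_subset ho h
  ct_subset := hs.ct_subset ho h
  executed := hs.executed ho h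
  signed := hs.signed ho h
  certified := hs.certified ho h
  authentic := hs.authentic h
  past := hs.past ho h
  sequenced := hs.sequenced h
  finite := hs.finite h.finite

theorem IsRun.sound {r : ℕ → State V Tx ObjID Eff} (hr : IsRun P byz r) (t : ℕ) :
    Sound P byz (r t) := by
  induction t with
  | zero => rw [hr.1]; exact sound_initial
  | succ t ih =>
    rcases hr.2 t with h | h
    · exact h.sound (hr.epochOrder t) ih
    · rwa [h]

end Soundness

/-! ### Safety: certified effects survive the end of the epoch. -/

section Safety

variable {V Tx ObjID Eff : Type*} {P : System V Tx ObjID} {byz : ℕ → Set V}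
  {r : ℕ → State V Tx ObjID Eff}

/-- `BFT` constrains nonempty committees only, and a quorum forces its committee to be nonempty.
Taking `A' = A` yields a correct member of a single quorum. -/
theorem BFT.exists_correct (hb : BFT P byz r) {t e : ℕ} {A A' : Set V}
    (hA : Quorum P (r t).logs e A) (hA' : Quorum P (r t).logs e A') :
    ∃ v ∈ committee P (r t).logs e, v ∈ A ∧ v ∈ A' ∧ v ∉ byz e :=
  IsQuorum.exists_correct (hb t e hA.nonempty) hA hA'

theorem IsRun.notMem_hist (hr : IsRun P byz r) (hb : BFT P byz r) {t e : ℕ} {T : Tx}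
    (hT : EffCert P (r t) e T) : T ∉ hist P (r t).logs e := by
  obtain ⟨E, hE⟩ := hT
  obtain ⟨v, -, hv, -, hc⟩ := hb.exists_correct hE hE
  exact ((hr.sound t).executed e v T hc ⟨E, hv⟩).fresh

/-- If the epoch has ended, a quorum has checked that its certificates are sequenced. -/
theorem IsRun.exists_sequenced (hr : IsRun P byz r) (hb : BFT P byz r) {t e : ℕ} {A : Set V}
    (he : EpochEnded P (r t).logs e) (hA : Quorum P (r t).logs e A) :
    ∃ v ∈ A, v ∉ byz e ∧ ∀ T, (e, v, .tx T) ∈ (r t).inputs → T ∈ ((r t).logs e).txs := by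
  obtain ⟨v, -, hv, hcall, hc⟩ := hb.exists_correct hA he.quorum
  have hs := hr.sound t
  exact ⟨v, hv, hc, hs.sequenced e v hc (hs.authentic e v hcall)⟩

/-- All commits of a closed epoch are causally complete. -/
theorem IsRun.causallyComplete (hr : IsRun P byz r) (hb : BFT P byz r) {t e : ℕ}
    (he : EpochEnded P (r t).logs e) :
    CausallyComplete P (hist P (r t).logs e) ((r t).logs e) ((r t).logs e).length := by
  have hs := hr.sound t
  refine causallyComplete_of_closed {T | T ∈ ((r t).logs e).txs} (by simp) ?_ fun _ h => h
  rintro T hT T' ⟨hn, ⟨k, hk, hp⟩ | ⟨hp, -⟩⟩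
  · obtain ⟨v, hv, hc, hseq⟩ :=
      hr.exists_sequenced hb he (hs.certified e T (Log.mem_txs.mp hT))
    -- A correct signer had executed the creator `T'`. As `T'` is in no earlier checkpoint, this
    -- happened in epoch `e` and made `T'` an input of that signer.
    have hT' := ((hs.signed e v T hc hv).2 k hk T' hp).resolve_left hn
    exact hseq T' (hs.executed e v T' hc hT').input
  · exact hp.mem_left

theorem IsRun.mem_checkpointed (hr : IsRun P byz r) (hb : BFT P byz r) {t₀ t e : ℕ} {T : Tx}
    (hT : EffCert P (r t₀) e T) (he : EpochEnded P (r t).logs e) :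
    T ∈ checkpointed P (hist P (r t).logs e) ((r t).logs e) := by
  -- The times `t₀` and `t` may come in either order. At their maximum the certificate exists and
  -- the log of the ended epoch is still the one of time `t`.
  have ho := hr.epochOrder t
  have hx := hr.extends (le_max_right t₀ t)
  have hT := (hr.extends (le_max_left t₀ t)).effCert (hr.epochOrder t₀) hT
  have he' := hx.epochEnded ho he
  rw [← hx.frozen e he, ← hx.hist_eq (ho.log_started e he.ne_nil)]
  refine Lutris.mem_checkpointed le_rfl (hr.causallyComplete hb he') ?_ (hr.notMem_hist hb hT)
  rw [List.take_length]
  obtain ⟨E, hE⟩ := hT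
  obtain ⟨v, hv, hc, hseq⟩ := hr.exists_sequenced hb he' hE
  exact hseq T ((hr.sound _).executed e v T hc ⟨E, hv⟩).input

/-- A transaction with an effect certificate is in the state that later epochs start from. -/
theorem IsRun.mem_hist (hr : IsRun P byz r) (hb : BFT P byz r) {t₀ t e e' : ℕ} {T : Tx}
    (hT : EffCert P (r t₀) e T) (he : EpochEnded P (r t).logs e) (hlt : e < e') :
    T ∈ hist P (r t).logs e' :=
  hist_mono (Nat.succ_le_of_lt hlt) (.inr (hr.mem_checkpointed hb hT he))

/-- Only entering a new epoch can shrink `ct`, and it resets `ct` to a `hist` that contains `T`. -/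
theorem IsRun.not_reverted (hr : IsRun P byz r) (hb : BFT P byz r) {t₀ t e : ℕ} {v : V} {T : Tx}
    (hT : EffCert P (r t₀) e T) (hle : e ≤ ((r t).loc v).epoch) :
    ¬ Reverted (r t) (r (t + 1)) v T := by
  rintro ⟨h1, h2⟩
  rcases hr.2 t with h | h
  · rcases h.loc v with ⟨-, -, h3⟩ | ⟨-, h3, -, -, h4⟩
    · exact h2 (h3 h1)
    · have ho := hr.epochOrder t
      have he := ho.started_succ (ho.epochEnded h3) e (Nat.lt_succ_of_le hle)
      rw [h4] at h2
      exact h2 (hr.mem_hist hb hT he (Nat.lt_succ_of_le hle))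
  · rw [h] at h2
    exact h2 h1

theorem IsRun.mem_ct (hr : IsRun P byz r) (hb : BFT P byz r) {t₀ t e : ℕ} {v : V} {T : Tx}
    (hT : EffCert P (r t₀) e T) (hlt : e < ((r t).loc v).epoch) : T ∈ ((r t).loc v).ct :=
  (hr.sound t).hist_subset v
    (hr.mem_hist hb hT ((hr.epochOrder t).loc_started v e hlt) hlt)

end Safety

/-! ### Liveness: the checkpoint is assembled within the epoch. -/

section Liveness

variable {V Tx ObjID Eff : Type*} {P : System V Tx ObjID} {byz : ℕ → Set V}
  {r : ℕ → State V Tx ObjID Eff}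

/-- In an epoch that never ends, everything executed by correct members is sequenced. -/
theorem IsRun.exists_mem_txs (hr : IsRun P byz r) (hl : ConsensusLive P byz r) {t e : ℕ}
    (hne : ∀ t, ¬ EpochEnded P (r t).logs e) {v : V} {T : Tx} (hc : v ∉ byz e)
    (hv : v ∈ committee P (r t).logs e) (hT : T ∈ executed (r t) e v) :
    ∃ t', T ∈ ((r t').logs e).txs := by
  obtain ⟨t', h | h⟩ := hl.sequenced t e v _ hc hv ((hr.sound t).executed e v T hc hT).input
  · exact ⟨t', Log.mem_txs.mpr h⟩
  · exact absurd h (hne t')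

/-- In an epoch that never ends, all commits become causally complete. -/
theorem IsRun.exists_causallyComplete (hr : IsRun P byz r) (hb : BFT P byz r)
    (hl : ConsensusLive P byz r) {t e : ℕ} (hst : Started P (r t).logs e)
    (hne : ∀ t, ¬ EpochEnded P (r t).logs e) :
    ∃ t' ≥ t, CausallyComplete P (hist P (r t').logs e) ((r t').logs e)
      ((r t).logs e).length := by
  have hs := hr.sound t
  set X : Set Tx := {T | ∃ v ∉ byz e, v ∈ committee P (r t).logs e ∧ T ∈ executed (r t) e v}
  have hfin : X.Finite := by
    refine (hs.finite.image fun m => m.2.2.1).subset ?_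
    rintro T ⟨v, -, -, E, hE⟩
    exact ⟨_, hE, rfl⟩
  have hseq : ∀ T ∈ X, ∀ᶠ u in Filter.atTop, T ∈ ((r u).logs e).txs := by
    rintro T ⟨v, hc, hv, hT⟩
    obtain ⟨u, hu⟩ := hr.exists_mem_txs hl hne hc hv hT
    filter_upwards [Filter.eventually_ge_atTop u] with w hw
    exact Log.txs_subset ((hr.extends hw).logs_prefix e) hu
  obtain ⟨u, hu, hut⟩ := (((Filter.eventually_all_finite hfin).mpr hseq).and
    (Filter.eventually_ge_atTop t)).exists
  have hx := hr.extends hut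
  have hp := hx.logs_prefix e
  refine ⟨u, hut, ?_⟩
  rw [hx.hist_eq hst]
  -- This set is closed under dependencies even with respect to the later log. Signers of a
  -- sequenced certificate had executed its creators, and a validator in `X` had executed all
  -- dependencies of what it executed.
  refine causallyComplete_of_closed ({T | T ∈ ((r t).logs e).txs} ∪ X) ?_ ?_ ?_
  · intro T hT
    obtain ⟨l, hl⟩ := hp
    rw [← hl, List.take_left] at hT
    exact .inl hT
  · rintro T hT T' ⟨hn, hd⟩
    rcases hT with hT | ⟨v, hc, hv, hT⟩
    · rcases hd with ⟨k, hk, hpar⟩ | ⟨hprec, -⟩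
      · have hcert : TxCert P (r t) e T := hs.certified e T (Log.mem_txs.mp hT)
        obtain ⟨v, hv, hsig, -, hc⟩ := hb.exists_correct hcert hcert
        exact .inr ⟨v, hc, hv, ((hs.signed e v T hc hsig).2 k hk T' hpar).resolve_left hn⟩
      · exact .inl (hprec.of_prefix (Log.txs_prefix hp) hT).mem_left
    · have hex := hs.executed e v T hc hT
      refine .inr ⟨v, hc, hv, ?_⟩
      rcases hd with ⟨k, hk, hpar⟩ | ⟨hprec, hsh⟩
      · exact (hex.parents k hk T' hpar).resolve_left hn
      -- An execution ahead of consensus involves no shared objects. Otherwise `T` was already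
      -- sequenced at time `t`, and its predecessors are fixed.
      · rcases hex.next with h0 | ⟨hmem, hnext⟩
        · obtain ⟨k, -, k', hk', -⟩ := hsh
          simp [h0] at hk'
        · exact (hnext T' (hprec.of_prefix (Log.txs_prefix hp) hmem) hsh).resolve_left hn
  · rintro T (hT | hT)
    exacts [Log.txs_subset hp hT, hu T hT]

/-- The cases are: `v` leaves the epoch; `v` stays although the epoch ends; the epoch never ends. In
the first two `v` sees the full log and the safety result applies. In the last, `v` waits for a
causally complete prefix containing `T`. -/
theorem IsRun.exists_mem_assembled (hr : IsRun P byz r) (hb : BFT P byz r)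
    (hl : ConsensusLive P byz r) {t₀ t e : ℕ} {v : V} {T : Tx} (hT : EffCert P (r t₀) e T)
    (hc : v ∉ byz e) (hv : v ∈ committee P (r t).logs e) (hloc : ((r t).loc v).epoch = e) :
    ∃ u, ((r u).loc v).epoch = e ∧ T ∈ (r u).assembled P v := by
  by_cases hleave : ∃ u ≥ t, ((r u).loc v).epoch ≠ e
  · obtain ⟨u, hu, hne⟩ := hleave
    obtain ⟨w, h1, h2, h3⟩ := hr.exists_seenLog_eq hu (hloc ▸ hne)
    rw [hloc] at h1 h2 h3
    refine ⟨w, h1, ?_⟩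
    rw [State.assembled, h1, h3]
    exact hr.mem_checkpointed hb hT h2
  push Not at hleave
  have hst : Started P (r t).logs e := hloc ▸ (hr.epochOrder t).loc_started v
  have hdel : ∀ u ≥ t, ∃ w ≥ u, ((r w).loc v).epoch = e ∧ (r u).logs e <+: (r w).seenLog v := by
    intro u hu
    have hx := hr.extends hu
    obtain ⟨w, hw, h1, h2⟩ := hl.delivered u e v hc (by rwa [hx.committee_eq hst]) (hleave u hu)
    refine ⟨w, hw, h1, ?_⟩
    rw [State.seenLog, h1]
    exact List.prefix_take_iff.mpr ⟨(hr.extends hw).logs_prefix e, h2⟩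
  by_cases hend : ∃ u, EpochEnded P (r u).logs e
  · obtain ⟨u, hu⟩ := hend
    have hu := (hr.extends (le_max_left u t)).epochEnded (hr.epochOrder u) hu
    obtain ⟨w, hw, h1, h2⟩ := hdel _ (le_max_right u t)
    have hx := hr.extends hw
    refine ⟨w, h1, ?_⟩
    have heq : (r w).seenLog v = (r w).logs e := by
      have hp := (r w).seenLog_prefix v
      rw [h1] at hp
      refine hp.eq_of_length_le ?_
      rw [hx.frozen e hu]
      exact h2.length_le
    rw [State.assembled, h1, heq]
    exact hr.mem_checkpointed hb hT (hx.epochEnded (hr.epochOrder _) hu)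
  push Not at hend
  obtain ⟨u, hu⟩ : ∃ u, T ∈ ((r u).logs e).txs := by
    obtain ⟨E, hE⟩ := id hT
    obtain ⟨w, hw, hsig, -, hcw⟩ := hb.exists_correct hE hE
    exact hr.exists_mem_txs hl hend hcw hw ⟨E, hsig⟩
  have hu := Log.txs_subset ((hr.extends (le_max_left u t)).logs_prefix e) hu
  have hst' := (hr.extends (le_max_right u t)).started hst
  obtain ⟨m, hm, hcomp⟩ := hr.exists_causallyComplete hb hl hst' hend
  obtain ⟨w, hw, h1, h2⟩ := hdel m ((le_max_right u t).trans hm)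
  have hx := hr.extends hm
  have hp := hx.logs_prefix e
  have hxw := hr.extends hw
  have hh := hxw.hist_eq (hx.started hst')
  refine ⟨w, h1, ?_⟩
  rw [State.assembled, h1, hh]
  -- The relevant commits are those output when `T` was sequenced. Their histories are complete in
  -- the log of time `m`, hence also in the longer log seen by `v` at time `w`.
  refine Lutris.mem_checkpointed (hp.length_le.trans h2.length_le)
    (hcomp.of_prefix h2 hp.length_le) ?_ ?_
  · obtain ⟨l, hl⟩ := hp.trans h2
    rwa [← hl, List.take_left]
  · have hT := (hr.extends (le_max_left t₀ w)).effCert (hr.epochOrder t₀) hT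
    have := hr.notMem_hist hb hT
    rwa [(hr.extends (le_max_right t₀ w)).hist_eq (hxw.started (hx.started hst')), hh] at this

end Liveness

end Lutris

theorem mainTheorem3 {V Tx ObjID Eff : Type*} (P : Lutris.System V Tx ObjID) (byz : ℕ → Set V)
    (r : ℕ → Lutris.State V Tx ObjID Eff) (hrun : Lutris.IsRun P byz r)
    (hbft : Lutris.BFT P byz r) (e : ℕ) (T : Tx)
    (hcert : ∃ t, Lutris.EffCert P (r t) e T) :
    (∀ t v, v ∉ byz ((r t).loc v).epoch → e ≤ ((r t).loc v).epoch →
      ¬ Lutris.Reverted (r t) (r (t + 1)) v T) ∧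
    (∀ t v, v ∉ byz ((r t).loc v).epoch → e < ((r t).loc v).epoch → T ∈ ((r t).loc v).ct) ∧
    (∀ t, Lutris.EpochEnded P (r t).logs e →
      T ∈ Lutris.checkpointed P (Lutris.hist P (r t).logs e) ((r t).logs e)) ∧
    (Lutris.ConsensusLive P byz r →
      ∀ v, v ∉ byz e → (∃ t, v ∈ Lutris.committee P (r t).logs e ∧ ((r t).loc v).epoch = e) →
        ∃ t, ((r t).loc v).epoch = e ∧ T ∈ (r t).assembled P v) := by
  obtain ⟨t₀, hT⟩ := hcert
  exact ⟨fun t v _ hle => hrun.not_reverted hbft hT hle,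
    fun t v _ hlt => hrun.mem_ct hbft hT hlt,
    fun t he => hrun.mem_checkpointed hbft hT he,
    fun hl v hc ⟨t, hv, hloc⟩ => hrun.exists_mem_assembled hbft hl hT hc hv hloc⟩
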